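/- Let $d$ be a positive odd integer, $n$ a number of modes and $\ell=\sqrt{2\pi/d}$. For $\mathbf a=(\mathbf a_X,\mathbf a_Z)$ and $\mathbf b=(\mathbf b_X,\mathbf b_Z)$ in $\mathbb R^{2n}$ put $[\mathbf a,\mathbf b]=\mathbf a_X\cdot\mathbf b_Z-\mathbf a_Z\cdot\mathbf b_X$, and let $\hat T_{\mathbf a}=e^{-i\ell(\mathbf a_X\cdot\hat{\mathbf p}-\mathbf a_Z\cdot\hat{\mathbf q})}$ be the displacement operator, where $\hat{\mathbf q}$ and $\hat{\mathbf p}=-i\nabla$ are the position and momentum operators on $\mathbb R^n$; explicitly, $(\hat T_{\mathbf a}f)(\mathbf x)=e^{i\ell\,\mathbf a_Z\cdot\mathbf x-i\pi\,\mathbf a_X\cdot\mathbf a_Z/d}f(\mathbf x-\ell\mathbf a_X)$. The Zak-Gross phase point operator at $\boldsymbol\eta\in[0,d\ell)^{2n}$ is $$\hat A_{\boldsymbol\eta}=\frac1{(2\pi)^n}\sum_{\mathbf a\in\mathbb Z^{2n}}e^{i\ell[\mathbf a,\boldsymbol\eta]+i\pi\,\mathbf a_X\cdot\mathbf a_Z}\,\hat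 T_{\mathbf a}.$$ For an integer $j$ let $|j_{\mathrm{GKP}}\rangle=\ell^{-1/2}\sum_{m\in\mathbb Z}|(dm+j)\ell\rangle$ (position eigenkets; a tempered distribution on $\mathbb R$), and let the logical parity operator be $$\hat\Pi_d^L=\Bigl(\sum_{j=0}^{d-1}|-j_{\mathrm{GKP}}\rangle\langle j_{\mathrm{GKP}}|\Bigr)^{\otimes n}.$$ Both are understood as linear maps from the Schwartz space $\mathcal S(\mathbb R^n)$ to the tempered distributions $\mathcal S'(\mathbb R^n)$, with convergence of operator sums meaning convergence of all matrix elements between Schwartz functions. Then the sum that defines $\hat A_{\boldsymbol\eta}$ at $\boldsymbol\eta=\mathbf 0$ converges unconditionally, and $$\hat A_{\mathbf 0}=\hat\Pi_d^L .$$ -/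

import Mathlib

open scoped SchwartzMap

noncomputable section

namespace GKP

/-- The configuration space `ℝⁿ` of `n` modes. -/
abbrev Config (n : ℕ) := EuclideanSpace ℝ (Fin n)

/-- The phase space `ℝ²ⁿ`; a vector `a = (a_X, a_Z)` is a pair, `a.1 = a_X` and `a.2 = a_Z`. -/
abbrev PhaseSpace (n : ℕ) := Config n × Config n

/-- The symplectic form `[a, b] = aᵀ Ω b = a_X · b_Z - a_Z · b_X`. -/
def symp {n : ℕ} (a b : PhaseSpace n) : ℝ := inner ℝ a.1 b.2 - inner ℝ a.2 b.1

/-- An integer vector as a point of `ℝⁿ`. -/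
def intVec {n : ℕ} (m : Fin n → ℤ) : Config n := WithLp.toLp 2 fun k => (m k : ℝ)

/-- An integer vector `(a_X, a_Z) ∈ ℤ²ⁿ` as a point of phase space. -/
def intPhase {n : ℕ} (a : (Fin n → ℤ) × (Fin n → ℤ)) : PhaseSpace n := (intVec a.1, intVec a.2)

/-- Generalized operators: continuous linear maps from Schwartz wave functions to tempered
distributions, with the topology of pointwise convergence, that is, of the convergence of all matrix
elements between Schwartz functions. The matrix element `B f g` is the (bilinear) pairing of the
distribution `B f` with the test function `g`. -/
abbrev GenOp (E : Type*) [NormedAddCommGroup E] [NormedSpace ℝ E] := 𝓢(E, ℂ) →Lₚₜ[ℂ] 𝓢'(E, ℂ)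

/-- An operator on Schwartz functions as a generalized operator, through the embedding
`f ↦ (g ↦ ∫ g f)` of Schwartz functions into tempered distributions. -/
def toGenOp {n : ℕ} (L : 𝓢(Config n, ℂ) →L[ℂ] 𝓢(Config n, ℂ)) : GenOp (Config n) :=
  ContinuousLinearMap.toPointwiseConvergenceCLM ℂ (RingHom.id ℂ) _ _
    (SchwartzMap.toTemperedDistributionCLM (Config n) ℂ MeasureTheory.volume ∘L L)

theorem toGenOp_apply {n : ℕ} (L : 𝓢(Config n, ℂ) →L[ℂ] 𝓢(Config n, ℂ))
    (f g : 𝓢(Config n, ℂ)) : toGenOp L f g = ∫ x, g x * L f x :=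
  SchwartzMap.toTemperedDistributionCLM_apply_apply MeasureTheory.volume (L f) g

/-! ### Displacement operators -/

theorem hasTemperateGrowth_cexp_ofReal_mul_I :
    (fun t : ℝ => Complex.exp (t * Complex.I)).HasTemperateGrowth := by
  have hd : ∀ n : ℕ, iteratedDeriv n (fun t : ℝ => Complex.exp (t * Complex.I)) =
      fun t : ℝ => Complex.I ^ n * Complex.exp (t * Complex.I) := by
    intro n
    induction n with
    | zero => simp
    | succ n ih =>
      rw [iteratedDeriv_succ, ih]
      ext t
      have h : HasDerivAt (fun t : ℝ => Complex.I ^ n * Complex.exp (t * Complex.I))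
          (Complex.I ^ n * (Complex.exp (t * Complex.I) * (1 * Complex.I))) t :=
        (((Complex.ofRealCLM.hasDerivAt (x := t)).mul_const Complex.I).cexp).const_mul _
      rw [h.deriv]
      ring
  refine ⟨(Complex.ofRealCLM.contDiff.mul contDiff_const).cexp, fun n => ⟨0, 1, fun t => ?_⟩⟩
  rw [norm_iteratedFDeriv_eq_norm_iteratedDeriv, hd]
  simp [Complex.norm_exp_ofReal_mul_I]

theorem hasTemperateGrowth_phase {n : ℕ} (b : Config n) :
    (fun x : Config n => Complex.exp ((inner ℝ b x : ℝ) * Complex.I)).HasTemperateGrowth :=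
  hasTemperateGrowth_cexp_ofReal_mul_I.comp (f := fun x : Config n => inner ℝ b x) (by fun_prop)

/-- The displacement operator `D(a) = exp(i aᵀ Ω r̂) = exp(i (a_X · p̂ - a_Z · q̂))` on Schwartz
functions, `(D(a) f)(x) = exp(-i a_X · a_Z / 2 - i a_Z · x) f(x + a_X)`. -/
def displacement {n : ℕ} (a : PhaseSpace n) : 𝓢(Config n, ℂ) →L[ℂ] 𝓢(Config n, ℂ) :=
  Complex.exp (-((inner ℝ a.1 a.2 / 2 : ℝ) * Complex.I)) •
    (SchwartzMap.smulLeftCLM ℂ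
        (fun x : Config n => Complex.exp ((inner ℝ (-a.2) x : ℝ) * Complex.I)) ∘L
      SchwartzMap.compSubConstCLM ℂ (-a.1))

theorem displacement_apply {n : ℕ} (a : PhaseSpace n) (f : 𝓢(Config n, ℂ)) (x : Config n) :
    displacement a f x =
      Complex.exp (-((inner ℝ a.1 a.2 / 2 + inner ℝ a.2 x : ℝ) * Complex.I)) * f (x + a.1) := by
  simp only [displacement, _root_.smul_apply, ContinuousLinearMap.comp_apply,
    SchwartzMap.smulLeftCLM_apply_apply (hasTemperateGrowth_phase _),
    SchwartzMap.compSubConstCLM_apply, sub_neg_eq_add, smul_eq_mul]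
  rw [← mul_assoc, ← Complex.exp_add]
  congr 2
  simp only [inner_neg_left]
  push_cast
  ring

/-- The position operator of mode `k`, `(q̂ₖ f)(x) = xₖ f(x)`. -/
def position {n : ℕ} (k : Fin n) : 𝓢(Config n, ℂ) →L[ℂ] 𝓢(Config n, ℂ) :=
  SchwartzMap.smulLeftCLM ℂ (fun x : Config n => (x k : ℂ))

/-- The momentum operator of mode `k`, `p̂ₖ = -i ∂/∂xₖ`. -/
def momentum {n : ℕ} (k : Fin n) : 𝓢(Config n, ℂ) →L[ℂ] 𝓢(Config n, ℂ) :=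
  (-Complex.I) • LineDeriv.lineDerivOpCLM ℂ 𝓢(Config n, ℂ) (EuclideanSpace.single k (1 : ℝ))

/-- The quadrature operator `aᵀ Ω r̂ = ∑ₖ (a_Xₖ p̂ₖ - a_Zₖ q̂ₖ)`, with
`r̂ = (q̂₁, …, q̂ₙ, p̂₁, …, p̂ₙ)`. -/
def quadrature {n : ℕ} (a : PhaseSpace n) : 𝓢(Config n, ℂ) →L[ℂ] 𝓢(Config n, ℂ) :=
  ∑ k, ((a.1 k : ℂ) • momentum k - (a.2 k : ℂ) • position k)

theorem displacement_zero {n : ℕ} :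
    displacement (0 : PhaseSpace n) = ContinuousLinearMap.id ℂ _ := by
  ext f x
  simp [displacement_apply]

/-- `t ↦ D(t a) f` solves `∂ₜ ψ = i (aᵀ Ω r̂) ψ`: this is the sense of `D(a) = exp(i aᵀ Ω r̂)`. -/
theorem hasDerivAt_displacement {n : ℕ} (a : PhaseSpace n) (f : 𝓢(Config n, ℂ)) (x : Config n)
    (t : ℝ) :
    HasDerivAt (fun s : ℝ => displacement (s • a) f x)
      (Complex.I * quadrature a (displacement (t • a) f) x) t := by
  set u := displacement (t • a) f with hu
  have hq : quadrature a u x =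
      -Complex.I * fderiv ℝ u x a.1 - (inner ℝ a.2 x : ℝ) * u x := by
    have h1 : a.1 = ∑ k, a.1 k • EuclideanSpace.single k (1 : ℝ) := by
      ext i
      simp [Finset.sum_apply, Pi.single_apply]
    have hpos : ∀ k, position k u x = x k * u x := fun k =>
      SchwartzMap.smulLeftCLM_apply_apply
        (Complex.ofRealCLM ∘L EuclideanSpace.proj (𝕜 := ℝ) k).hasTemperateGrowth u x
    have hmom : ∀ k, momentum k u x =
        -Complex.I * fderiv ℝ u x (EuclideanSpace.single k (1 : ℝ)) := fun k => rfl
    have hf : fderiv ℝ u x a.1 =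
        ∑ k, (a.1 k : ℂ) * fderiv ℝ u x (EuclideanSpace.single k (1 : ℝ)) := by
      conv_lhs => rw [h1]
      simp
    have hi : ((inner ℝ a.2 x : ℝ) : ℂ) = ∑ k, (a.2 k : ℂ) * (x k : ℂ) := by
      simp [PiLp.inner_apply, mul_comm]
    have hs : quadrature a u x =
        ∑ k, ((a.1 k : ℂ) * momentum k u x - (a.2 k : ℂ) * position k u x) := by
      simp [quadrature, _root_.sum_apply]
    rw [hs, hf, hi, Finset.mul_sum, Finset.sum_mul, ← Finset.sum_sub_distrib]
    refine Finset.sum_congr rfl fun k _ => ?_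
    rw [hpos, hmom]
    ring
  have hline : ∀ y v : Config n, ∀ w : 𝓢(Config n, ℂ), ∀ s : ℝ,
      HasDerivAt (fun r : ℝ => w (y + r • v)) (fderiv ℝ w (y + s • v) v) s := by
    intro y v w s
    have h2 : HasDerivAt (fun r : ℝ => y + r • v) v s := by
      simpa using ((hasDerivAt_id s).smul_const v).const_add y
    exact (w.differentiableAt (x := y + s • v)).hasFDerivAt.comp_hasDerivAt s h2
  have hexp : ∀ (g : ℝ → ℝ) (g' s : ℝ), HasDerivAt g g' s →
      HasDerivAt (fun r : ℝ => Complex.exp (-((g r : ℝ) * Complex.I)))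
        (Complex.exp (-((g s : ℝ) * Complex.I)) * -(g' * Complex.I)) s := fun g g' s hg =>
    ((hg.ofReal_comp.mul_const Complex.I).neg).cexp
  have hfd : fderiv ℝ u x a.1 =
      Complex.exp (-((t * t * inner ℝ a.1 a.2 / 2 + t * inner ℝ a.2 x : ℝ) * Complex.I)) *
        (-((t * inner ℝ a.2 a.1 : ℝ) * Complex.I) * f (x + t • a.1)
          + fderiv ℝ f (x + t • a.1) a.1) := by
    have h3 := hline x a.1 u 0
    have h4 : (fun r : ℝ => u (x + r • a.1)) = fun r : ℝ =>
        Complex.exp (-((t * t * inner ℝ a.1 a.2 / 2 + t * inner ℝ a.2 x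
          + r * (t * inner ℝ a.2 a.1) : ℝ) * Complex.I)) * f ((x + t • a.1) + r • a.1) := by
      ext r
      rw [hu, displacement_apply]
      congr 1
      · congr 4
        simp only [Prod.smul_fst, Prod.smul_snd, inner_smul_left, inner_smul_right, inner_add_right]
        simp
        ring
      · congr 1
        simp only [Prod.smul_fst]
        abel
    rw [h4] at h3
    have h5 : HasDerivAt (fun r : ℝ => t * t * inner ℝ a.1 a.2 / 2 + t * inner ℝ a.2 x
        + r * (t * inner ℝ a.2 a.1)) (t * inner ℝ a.2 a.1) 0 := by
      simpa using ((hasDerivAt_id (0 : ℝ)).mul_const (t * inner ℝ a.2 a.1)).const_add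
          (t * t * inner ℝ a.1 a.2 / 2 + t * inner ℝ a.2 x)
    have h6 := h3.unique ((hexp _ _ _ h5).mul (hline (x + t • a.1) a.1 f 0))
    simp only [zero_smul, add_zero, zero_mul] at h6
    rw [h6]
    ring
  have hux : u x = Complex.exp (-((t * t * inner ℝ a.1 a.2 / 2 + t * inner ℝ a.2 x : ℝ)
      * Complex.I)) * f (x + t • a.1) := by
    rw [hu, displacement_apply]
    congr 4
    simp only [Prod.smul_fst, Prod.smul_snd, inner_smul_left, inner_smul_right]
    simp
    ring
  have hfun : (fun s : ℝ => displacement (s • a) f x) = fun s : ℝ =>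
      Complex.exp (-((s * s * inner ℝ a.1 a.2 / 2 + s * inner ℝ a.2 x : ℝ) * Complex.I))
        * f (x + s • a.1) := by
    ext s
    rw [displacement_apply]
    congr 4
    simp only [Prod.smul_fst, Prod.smul_snd, inner_smul_left, inner_smul_right]
    simp
    ring
  rw [hfun, hq, hfd, hux]
  have h7 : HasDerivAt (fun s : ℝ => s * s * inner ℝ a.1 a.2 / 2 + s * inner ℝ a.2 x)
      (t * inner ℝ a.1 a.2 + inner ℝ a.2 x) t := by
    have h8 := ((((hasDerivAt_id t).mul (hasDerivAt_id t)).mul_const (inner ℝ a.1 a.2)).div_const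
      2).add ((hasDerivAt_id t).mul_const (inner ℝ a.2 x))
    refine h8.congr_deriv ?_
    simp
    ring
  refine ((hexp _ _ t h7).mul (hline x a.1 f t)).congr_deriv ?_
  rw [real_inner_comm a.1 a.2]
  push_cast
  linear_combination (Complex.exp (-((t * t * inner ℝ a.1 a.2 / 2 + t * inner ℝ a.2 x : ℂ)
      * Complex.I)) * (-((t * inner ℝ a.1 a.2 : ℂ) * Complex.I) * f (x + t • a.1)
          + fderiv ℝ f (x + t • a.1) a.1)) * Complex.I_sq

/-- The GKP lattice spacing `ℓ = √(2π/d)`. -/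
def spacing (d : ℕ) : ℝ := Real.sqrt (2 * Real.pi / d)

/-- `T_a = D(-ℓ a)`. -/
def T (d : ℕ) {n : ℕ} (a : PhaseSpace n) : 𝓢(Config n, ℂ) →L[ℂ] 𝓢(Config n, ℂ) :=
  displacement (-(spacing d • a))

/-- The summand `exp(i ℓ [a, η] + i π a_X · a_Z) T_a` of the phase point operator. -/
def phasePointTerm (d : ℕ) {n : ℕ} (η : PhaseSpace n) (a : (Fin n → ℤ) × (Fin n → ℤ)) :
    GenOp (Config n) :=
  Complex.exp (((spacing d * symp (intPhase a) η
      + Real.pi * inner ℝ (intPhase a).1 (intPhase a).2 : ℝ) : ℂ) * Complex.I) •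
    toGenOp (T d (intPhase a))

/-- The Zak-Gross phase point operator
`A_η = (2π)⁻ⁿ ∑_{a ∈ ℤ²ⁿ} exp(i ℓ [a, η] + i π a_X · a_Z) T_a`. -/
def phasePoint (d : ℕ) {n : ℕ} (η : PhaseSpace n) : GenOp (Config n) :=
  (1 / (2 * Real.pi : ℂ) ^ n) • ∑' a : (Fin n → ℤ) × (Fin n → ℤ), phasePointTerm d η a

/-! ### Bras, kets and ideal GKP states -/

section Dirac

variable {E : Type*} [NormedAddCommGroup E] [NormedSpace ℝ E]

/-- Complex conjugation of a Schwartz function. -/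
def conjS (f : 𝓢(E, ℂ)) : 𝓢(E, ℂ) :=
  SchwartzMap.postcompCLM (𝕜 := ℝ) (Complex.conjCLE : ℂ →L[ℝ] ℂ) f

theorem conjS_apply (f : 𝓢(E, ℂ)) (x : E) : conjS f x = (starRingEnd ℂ) (f x) := rfl

/-- The bra `⟨φ|` of a tempered distribution `φ`: `⟨φ|f⟩` is the complex conjugate of `φ(f̄)`. -/
def bra (φ : 𝓢'(E, ℂ)) : 𝓢(E, ℂ) →L[ℂ] ℂ where
  toFun f := (starRingEnd ℂ) (φ (conjS f))
  map_add' f g := by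
    have h : conjS (f + g) = conjS f + conjS g := map_add _ f g
    rw [h, map_add, map_add]
  map_smul' c f := by
    have h : conjS (c • f) = (starRingEnd ℂ) c • conjS f := by
      ext x
      simp [conjS_apply]
    simp [h]
  cont := Complex.continuous_conj.comp (φ.continuous.comp
    (SchwartzMap.postcompCLM (𝕜 := ℝ) (Complex.conjCLE : ℂ →L[ℝ] ℂ)).continuous)

/-- The generalized operator `|ψ⟩⟨φ|`, `f ↦ ⟨φ|f⟩ ψ`. -/
def ketBra (ψ φ : 𝓢'(E, ℂ)) : GenOp E where
  toFun f := bra φ f • ψ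
  map_add' f g := by
    ext g
    simp [add_mul]
  map_smul' c f := by
    ext g
    simp [mul_assoc]
  cont := PointwiseConvergenceCLM.continuous_of_continuous_eval fun g =>
    (bra φ).continuous.mul continuous_const

theorem ketBra_apply (ψ φ : 𝓢'(E, ℂ)) (f g : 𝓢(E, ℂ)) :
    ketBra ψ φ f g = (starRingEnd ℂ) (φ (conjS f)) * ψ g := rfl

/-- The position eigenket `|x⟩`. -/
def positionKet (x : E) : 𝓢'(E, ℂ) := TemperedDistribution.delta x

/-- A sum of position eigenkets over points of polynomial density converges to a tempered
distribution. -/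
theorem hasSum_positionKet {ι : Type*} (x : ι → E) (k : ℕ)
    (hx : Summable fun i => ((1 + ‖x i‖) ^ k)⁻¹) (f : 𝓢(E, ℂ)) :
    Summable (fun i => positionKet (x i)) ∧ Summable (fun i => ‖f (x i)‖) ∧
      (∑' i, positionKet (x i)) f = ∑' i, f (x i) := by
  have hb : ∀ (g : 𝓢(E, ℂ)) i, ‖g (x i)‖ ≤
      2 ^ k * (Finset.Iic (k, 0)).sup (schwartzSeminormFamily ℂ E ℂ) g * ((1 + ‖x i‖) ^ k)⁻¹ := by
    intro g i
    have h := SchwartzMap.one_add_le_sup_seminorm_apply (𝕜 := ℂ) (m := (k, 0)) (le_refl k)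
      (le_refl 0) g (x i)
    rw [norm_iteratedFDeriv_zero] at h
    rw [← div_eq_mul_inv, le_div_iff₀ (by positivity), mul_comm]
    exact h
  have hs : ∀ g : 𝓢(E, ℂ), Summable fun i => ‖g (x i)‖ := fun g =>
    Summable.of_nonneg_of_le (fun _ => norm_nonneg _) (hb g) (hx.mul_left _)
  let φ : 𝓢(E, ℂ) →L[ℂ] ℂ := SchwartzMap.mkCLMtoNormedSpace (fun g => ∑' i, g (x i))
    (fun g h => (hs g).of_norm.tsum_add (hs h).of_norm)
    (fun c g => tsum_mul_left)
    ⟨Finset.Iic (k, 0), 2 ^ k * ∑' i, ((1 + ‖x i‖) ^ k)⁻¹,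
      mul_nonneg (by positivity) (tsum_nonneg fun _ => by positivity), fun g => by
      refine (norm_tsum_le_tsum_norm (hs g)).trans (((hs g).tsum_le_tsum (hb g)
        (hx.mul_left _)).trans (le_of_eq ?_))
      rw [tsum_mul_left]
      ring⟩
  let φ' : 𝓢'(E, ℂ) := ContinuousLinearMap.toPointwiseConvergenceCLM ℂ (RingHom.id ℂ) _ _ φ
  have hφ : HasSum (fun i => positionKet (x i)) φ' := by
    unfold HasSum
    rw [PointwiseConvergenceCLM.tendsto_iff_forall_tendsto]
    intro g
    have h := (hs g).of_norm.hasSum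
    unfold HasSum at h
    refine h.congr fun s => ?_
    simp [positionKet]
  refine ⟨hφ.summable, hs f, ?_⟩
  rw [hφ.tsum_eq]
  rfl

end Dirac

theorem hasSum_prod_pi {n : ℕ} (f : Fin n → ℤ → ℂ) (hf : ∀ k, Summable fun m => ‖f k m‖) :
    Summable (fun m : Fin n → ℤ => ‖∏ k, f k (m k)‖) ∧
      ∑' m : Fin n → ℤ, ∏ k, f k (m k) = ∏ k, ∑' m, f k m := by
  induction n with
  | zero => simp [Summable.of_finite]
  | succ n ih =>
    obtain ⟨h1, h2⟩ := ih (fun k => f k.succ) fun k => hf k.succ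
    let e := Fin.consEquiv fun _ : Fin (n + 1) => ℤ
    have h3 : ∀ p : ℤ × (Fin n → ℤ), ∏ k, f k (e p k) =
        f 0 p.1 * ∏ k : Fin n, f k.succ (p.2 k) := fun p => by
      simp [e, Fin.prod_univ_succ, Fin.consEquiv]
    constructor
    · rw [← e.summable_iff]
      refine ((hf 0).mul_norm h1).congr fun p => ?_
      simp only [Function.comp_apply, h3]
    · rw [← e.tsum_eq, Fin.prod_univ_succ, ← h2, tsum_mul_tsum_of_summable_norm (hf 0) h1]
      exact tsum_congr h3

theorem spacing_pos {d : ℕ} (hd : d ≠ 0) : 0 < spacing d := by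
  unfold spacing
  positivity

theorem summable_comb {d : ℕ} (hd : d ≠ 0) (j : ℤ) :
    Summable fun m : ℤ => ((1 + ‖((d * m + j : ℤ) : ℝ) * spacing d‖) ^ 2)⁻¹ := by
  have hl := spacing_pos hd
  have hd' : (0 : ℝ) < d := by positivity
  have h := ((Real.summable_one_div_int_add_rpow ((j : ℝ) / d) 2).2 (by norm_num)).mul_left
    (((spacing d * d) ^ 2)⁻¹)
  refine h.of_norm_bounded_eventually (Set.Finite.subset (Set.finite_le_nat 0 |>.image
    fun _ => (-j) / (d : ℤ)) fun m hm => ?_)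
  have h0 : (m : ℝ) + (j : ℝ) / d = 0 := by
    by_contra h0
    apply hm
    have h1 : 0 < |(m : ℝ) + (j : ℝ) / d| := abs_pos.2 h0
    have h2 : spacing d * d * |(m : ℝ) + (j : ℝ) / d| = ‖((d * m + j : ℤ) : ℝ) * spacing d‖ := by
      rw [Real.norm_eq_abs, abs_mul, abs_of_pos hl, ← abs_of_pos hd', mul_assoc, ← abs_mul,
        abs_of_pos hd', mul_comm]
      congr 2
      push_cast
      field_simp
    rw [Set.mem_ofPred_eq, Real.norm_of_nonneg (by positivity), one_div, ← mul_inv,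
      Real.rpow_ofNat, ← mul_pow, h2]
    have h3 : 0 < ‖((d * m + j : ℤ) : ℝ) * spacing d‖ := by rw [← h2]; positivity
    gcongr
    linarith
  refine ⟨0, by simp, ?_⟩
  have h1 : (d : ℤ) * m = -j := by
    field_simp at h0
    have : (d : ℝ) * m = -j := by linarith
    exact_mod_cast this
  show (-j) / (d : ℤ) = m
  rw [← h1]
  exact Int.mul_ediv_cancel_left _ (by exact_mod_cast hd)


/-- The ideal one-mode GKP state `|j_GKP⟩ = ℓ^(-1/2) ∑ₘ |(d m + j) ℓ⟩`, for any integer `j` (it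
depends on `j` modulo `d` only). -/
def gkpKet (d : ℕ) (j : ℤ) : 𝓢'(ℝ, ℂ) :=
  (1 / Real.sqrt (spacing d) : ℂ) •
    ∑' m : ℤ, positionKet (((d * m + j : ℤ) : ℝ) * spacing d)

/-- The one-mode logical parity operator `∑_{j = 0}^{d-1} |-j_GKP⟩⟨j_GKP|`. -/
def logicalParityOne (d : ℕ) : GenOp ℝ :=
  ∑ j : Fin d, ketBra (gkpKet d (-(j : ℤ))) (gkpKet d (j : ℤ))

/-- The `n`-mode product state `|j₁_GKP⟩ ⊗ ⋯ ⊗ |jₙ_GKP⟩`, with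
`|x₁⟩ ⊗ ⋯ ⊗ |xₙ⟩ = |(x₁, …, xₙ)⟩`. -/
def gkpKetMulti (d : ℕ) {n : ℕ} (j : Fin n → ℤ) : 𝓢'(Config n, ℂ) :=
  (1 / Real.sqrt (spacing d) : ℂ) ^ n •
    ∑' m : Fin n → ℤ, positionKet (spacing d • intVec fun k => d * m k + j k)

theorem gkpKet_apply {d : ℕ} (hd : d ≠ 0) (j : ℤ) (f : 𝓢(ℝ, ℂ)) :
    gkpKet d j f = (1 / Real.sqrt (spacing d) : ℂ) *
      ∑' m : ℤ, f (((d * m + j : ℤ) : ℝ) * spacing d) := by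
  obtain ⟨h1, -, h3⟩ := hasSum_positionKet _ 2 (summable_comb hd j) f
  rw [← h3]
  rfl

theorem summable_combMulti {d n : ℕ} (hd : d ≠ 0) (j : Fin n → ℤ) :
    Summable fun m : Fin n → ℤ =>
      ((1 + ‖spacing d • intVec fun k => d * m k + j k‖) ^ (2 * n))⁻¹ := by
  have h3 : ∀ (k : Fin n) (m : ℤ),
      ‖((((1 + ‖((d * m + j k : ℤ) : ℝ) * spacing d‖) ^ 2)⁻¹ : ℝ) : ℂ)‖ =
        ((1 + ‖((d * m + j k : ℤ) : ℝ) * spacing d‖) ^ 2)⁻¹ := fun k m => by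
    rw [Complex.norm_real, Real.norm_of_nonneg (by positivity)]
  have h := (hasSum_prod_pi (fun (k : Fin n) (m : ℤ) =>
    ((((1 + ‖((d * m + j k : ℤ) : ℝ) * spacing d‖) ^ 2)⁻¹ : ℝ) : ℂ)) (fun k =>
      (summable_comb hd (j k)).congr fun m => (h3 k m).symm)).1
  refine Summable.of_nonneg_of_le (fun _ => by positivity) (fun m => ?_) h
  have h1 : ∀ k : Fin n, ‖((d * m k + j k : ℤ) : ℝ) * spacing d‖ ≤
      ‖spacing d • intVec fun k => d * m k + j k‖ := fun k => by
    have h2 := PiLp.norm_apply_le (spacing d • intVec fun k => d * m k + j k) k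
    simpa [intVec, mul_comm] using h2
  rw [norm_prod, pow_mul]
  simp only [h3, Finset.prod_inv_distrib]
  refine inv_anti₀ (Finset.prod_pos fun k _ => by positivity) ?_
  calc _ ≤ ∏ _k : Fin n, (1 + ‖spacing d • intVec fun k => d * m k + j k‖) ^ 2 :=
        Finset.prod_le_prod (fun k _ => by positivity) fun k _ => by
          gcongr
          exact h1 k
    _ = _ := by simp

theorem gkpKetMulti_apply {d n : ℕ} (hd : d ≠ 0) (j : Fin n → ℤ) (f : 𝓢(Config n, ℂ)) :
    gkpKetMulti d j f = (1 / Real.sqrt (spacing d) : ℂ) ^ n *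
      ∑' m : Fin n → ℤ, f (spacing d • intVec fun k => d * m k + j k) := by
  obtain ⟨h1, -, h3⟩ := hasSum_positionKet _ _ (summable_combMulti hd j) f
  rw [← h3]
  rfl

theorem gkpKetMulti_prod {d n : ℕ} (hd : d ≠ 0) (j : Fin n → ℤ) (f : Fin n → 𝓢(ℝ, ℂ))
    (F : 𝓢(Config n, ℂ)) (hF : ∀ x, F x = ∏ k, f k (x k)) :
    gkpKetMulti d j F = ∏ k, gkpKet d (j k) (f k) := by
  simp only [gkpKetMulti_apply hd, gkpKet_apply hd, hF, Finset.prod_mul_distrib]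
  rw [← (hasSum_prod_pi _ fun k => (hasSum_positionKet _ 2 (summable_comb hd (j k)) (f k)).2.1).2]
  simp [intVec, mul_comm]

/-- The logical parity operator `Π_d^L = (∑ⱼ |-j_GKP⟩⟨j_GKP|)^{⊗ n}`, with the tensor power expanded
over `j ∈ {0, …, d-1}ⁿ`. -/
def logicalParity (d n : ℕ) : GenOp (Config n) :=
  ∑ j : Fin n → Fin d,
    ketBra (gkpKetMulti d fun k => -(j k : ℤ)) (gkpKetMulti d fun k => (j k : ℤ))

/-- `B` is the `n`-fold tensor power of `b`: on product functions the matrix elements of `B` are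
the products of those of `b`. (Product functions span a dense subspace, so this determines `B`.) -/
def IsTensorPower {n : ℕ} (b : GenOp ℝ) (B : GenOp (Config n)) : Prop :=
  ∀ (f g : Fin n → 𝓢(ℝ, ℂ)) (F G : 𝓢(Config n, ℂ)),
    (∀ x, F x = ∏ k, f k (x k)) → (∀ x, G x = ∏ k, g k (x k)) → B F G = ∏ k, b (f k) (g k)

theorem isTensorPower_logicalParity {d : ℕ} (hd : d ≠ 0) (n : ℕ) :
    IsTensorPower (logicalParityOne d) (logicalParity d n) := by
  intro f g F G hF hG
  have hc : ∀ x, conjS F x = ∏ k, conjS (f k) (x k) := fun x => by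
    simp [conjS_apply, hF, map_prod]
  have h1 : ∀ (f g : 𝓢(ℝ, ℂ)), logicalParityOne d f g =
      ∑ j : Fin d, ketBra (gkpKet d (-(j : ℤ))) (gkpKet d (j : ℤ)) f g := fun f g => by
    simp [logicalParityOne]
  have h2 : logicalParity d n F G = ∑ j : Fin n → Fin d,
      ketBra (gkpKetMulti d fun k => -(j k : ℤ)) (gkpKetMulti d fun k => (j k : ℤ)) F G := by
    simp [logicalParity]
  simp only [h1, h2, Finset.prod_univ_sum, Fintype.piFinset_univ, ketBra_apply,
    gkpKetMulti_prod hd _ _ _ hc, gkpKetMulti_prod hd _ _ _ hG, map_prod, Finset.prod_mul_distrib]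

end GKP

end

/-!
A matrix element of `T_a` between Schwartz functions is an overlap of one of them with a translate
of the other by `ℓ a_X`; by Parseval it is also an overlap with a translate by a multiple of `a_Z`.
It therefore decays rapidly in `a_X` and, separately, in `a_Z`, hence, by taking the geometric mean
of the two bounds, in both, and the sum over `ℤ²ⁿ` converges absolutely.

The sum over `a_Z = q` is evaluated by Poisson summation. Since `d = 2 r + 1` is odd, the phase
`π a_X · a_Z` only moves the resulting comb by a lattice vector, and the matrix element becomes a
sum of `f(ℓ u) g(ℓ v)` over `u = d k - (r + 1) p` and `v = d k - r p` with integer vectors `k` and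
`p = a_X`. A unimodular change of coordinates shows that these are all the pairs with `u + v ≡ 0`
modulo `d`; sorted by the residue of `u`, they form the products of the GKP states `j` and `-j`.
-/

noncomputable section

open MeasureTheory
open scoped FourierTransform

namespace GKP

section Decay

variable {E : Type*} [NormedAddCommGroup E]

theorem one_add_norm_le_mul (x y : E) : 1 + ‖y‖ ≤ (1 + ‖x‖) * (1 + ‖x - y‖) := by
  have htri : ‖y‖ ≤ ‖x‖ + ‖x - y‖ := by simpa using norm_sub_le x (x - y)
  nlinarith [mul_nonneg (norm_nonneg x) (norm_nonneg (x - y))]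

theorem inv_one_add_norm_sub_pow_le (x y : E) (N : ℕ) :
    ((1 + ‖x - y‖) ^ N)⁻¹ ≤ (1 + ‖x‖) ^ N * ((1 + ‖y‖) ^ N)⁻¹ := by
  rw [← div_eq_mul_inv, inv_eq_one_div, div_le_div_iff₀ (by positivity) (by positivity), one_mul,
    ← mul_pow]
  gcongr
  exact one_add_norm_le_mul x y

variable [NormedSpace ℝ E] {F G : Type*} [NormedAddCommGroup F] [NormedSpace ℝ F]
  [NormedAddCommGroup G] [NormedSpace ℝ G]

theorem exists_norm_le_mul_inv_one_add_norm_pow (f : 𝓢(E, F)) (N : ℕ) :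
    ∃ C, 0 ≤ C ∧ ∀ x, ‖f x‖ ≤ C * ((1 + ‖x‖) ^ N)⁻¹ := by
  refine ⟨2 ^ N * (Finset.Iic (N, 0)).sup (schwartzSeminormFamily ℝ E F) f,
    mul_nonneg (by positivity) (apply_nonneg _ _), fun x => ?_⟩
  rw [← div_eq_mul_inv, le_div_iff₀' (by positivity), ← norm_iteratedFDeriv_zero (𝕜 := ℝ) (f := f)]
  exact SchwartzMap.one_add_le_sup_seminorm_apply (𝕜 := ℝ) (m := (N, 0)) le_rfl le_rfl f x

theorem integrable_one_add_norm_pow_mul_norm [MeasurableSpace E] [BorelSpace E]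
    [SecondCountableTopology E] (μ : Measure E) [μ.HasTemperateGrowth] (g : 𝓢(E, F)) (N : ℕ) :
    Integrable (fun x => (1 + ‖x‖) ^ N * ‖g x‖) μ := by
  simp only [add_comm (1 : ℝ), add_pow, one_pow, mul_one, Finset.sum_mul, mul_right_comm _ _ ‖g _‖]
  exact integrable_finsetSum _ fun k _ => (g.integrable_pow_mul μ k).mul_const _

theorem exists_integral_norm_mul_norm_sub_le [MeasurableSpace E] [BorelSpace E]
    [SecondCountableTopology E] (μ : Measure E) [μ.HasTemperateGrowth] (g : 𝓢(E, F)) (f : 𝓢(E, G))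
    (N : ℕ) :
    ∃ C, 0 ≤ C ∧ ∀ c, ∫ x, ‖g x‖ * ‖f (x - c)‖ ∂μ ≤ C * ((1 + ‖c‖) ^ N)⁻¹ := by
  obtain ⟨B, hB, hf⟩ := exists_norm_le_mul_inv_one_add_norm_pow f N
  refine ⟨B * ∫ x, (1 + ‖x‖) ^ N * ‖g x‖ ∂μ,
    mul_nonneg hB (integral_nonneg fun x => by positivity), fun c => ?_⟩
  rw [mul_right_comm, ← integral_const_mul]
  refine integral_mono_of_nonneg (.of_forall fun x => by positivity)
    ((integrable_one_add_norm_pow_mul_norm μ g N).const_mul _) (.of_forall fun x => ?_)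
  calc ‖g x‖ * ‖f (x - c)‖
      ≤ ‖g x‖ * (B * ((1 + ‖x‖) ^ N * ((1 + ‖c‖) ^ N)⁻¹)) := by
        gcongr
        exact (hf _).trans (by gcongr; exact inv_one_add_norm_sub_pow_le x c N)
    _ = B * ((1 + ‖c‖) ^ N)⁻¹ * ((1 + ‖x‖) ^ N * ‖g x‖) := by ring

end Decay

section LatticeSums

variable {n : ℕ}

theorem summable_inv_norm_intVec_pow {N : ℕ} (hN : n < N) :
    Summable fun m : Fin n → ℤ => (‖intVec m‖ ^ N)⁻¹ := by
  let b := (EuclideanSpace.basisFun (Fin n) ℝ).toBasis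
  let e := (b.restrictScalars ℤ).equivFun.symm
  have he (m : Fin n → ℤ) : (e m : Config n) = intVec m := by
    have hcoe : (e m : Config n) = ∑ i, m i • b i := by
      simp only [e, Module.Basis.equivFun_symm_apply, AddSubmonoidClass.coe_finsetSum,
        Submodule.coe_smul, Module.Basis.restrictScalars_apply]
    rw [hcoe]
    ext i
    simp [b, intVec, WithLp.ofLp_sum, Finset.sum_apply, Pi.single_apply]
  have hL := ZLattice.summable_norm_pow_inv (Submodule.span ℤ (Set.range b)) N (by
    rwa [Module.finrank_eq_card_basis (b.restrictScalars ℤ), Fintype.card_fin])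
  exact (e.toEquiv.summable_iff.2 hL).congr fun m => by simp [← he]

theorem summable_inv_one_add_norm_smul_intVec {N : ℕ} (hN : n < N) {c : ℝ} (hc : c ≠ 0) :
    Summable fun m : Fin n → ℤ => ((1 + ‖c • intVec m‖) ^ N)⁻¹ := by
  refine ((summable_inv_norm_intVec_pow hN).mul_left (‖c‖ ^ N)⁻¹).of_norm_bounded_eventually ?_
  filter_upwards [Filter.eventually_cofinite_ne 0] with m hm
  have hpos : 0 < ‖c • intVec m‖ := norm_pos_iff.2 <| smul_ne_zero hc fun h0 =>
    hm <| funext fun i => by simpa [intVec] using congrArg (fun v : Config n => v i) h0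
  rw [Real.norm_of_nonneg (by positivity), ← mul_inv, ← mul_pow, ← norm_smul]
  gcongr
  exact le_add_of_nonneg_left zero_le_one

theorem summable_norm_smul_intVec (f : 𝓢(Config n, ℂ)) {c : ℝ} (hc : c ≠ 0) :
    Summable fun m : Fin n → ℤ => ‖f (c • intVec m)‖ :=
  (hasSum_positionKet _ _ (summable_inv_one_add_norm_smul_intVec n.lt_succ_self hc) f).2.1

end LatticeSums

section UnitCube

variable {ι : Type*}

/-- The half-open unit cube with corner `m`. The cubes are open on the left, in accordance with
Mathlib's `UnitAddTorus.measurableEquivPiIoc`. -/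
def unitCube (m : ι → ℤ) : Set (ι → ℝ) :=
  {x | ∀ i, x i ∈ Set.Ioc (m i : ℝ) (m i + 1)}

theorem mem_unitCube_iff {m : ι → ℤ} {x : ι → ℝ} : x ∈ unitCube m ↔ m = fun i => ⌈x i⌉ - 1 := by
  simp only [unitCube, Set.mem_ofPred_eq, Set.mem_Ioc, funext_iff]
  refine forall_congr' fun i => ?_
  rw [eq_sub_iff_add_eq, eq_comm, Int.ceil_eq_iff]
  push_cast
  rw [add_sub_cancel_right]

theorem iUnion_unitCube : ⋃ m : ι → ℤ, unitCube m = Set.univ :=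
  Set.eq_univ_of_forall fun _ => Set.mem_iUnion.2 ⟨_, mem_unitCube_iff.2 rfl⟩

theorem pairwise_disjoint_unitCube :
    Pairwise fun m m' : ι → ℤ => Disjoint (unitCube m) (unitCube m') :=
  fun _ _ hne => Set.disjoint_left.2 fun _ hx hx' =>
    hne ((mem_unitCube_iff.1 hx).trans (mem_unitCube_iff.1 hx').symm)

theorem measurableSet_unitCube [Countable ι] (m : ι → ℤ) : MeasurableSet (unitCube m) :=
  MeasurableSet.univ_pi' fun _ => measurableSet_Ioc

variable [Fintype ι] {E : Type*} [NormedAddCommGroup E] [NormedSpace ℝ E]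

theorem setIntegral_unitCube (f : (ι → ℝ) → E) (m : ι → ℤ) :
    ∫ x in unitCube m, f x = ∫ x in unitCube (0 : ι → ℤ), f (x + fun i => (m i : ℝ)) := by
  rw [← (measurePreserving_add_right volume fun i => (m i : ℝ)).setIntegral_preimage_emb
    (measurableEmbedding_addRight _)]
  congr 2
  ext x
  simp [unitCube, add_comm (x _)]

theorem hasSum_setIntegral_unitCube {f : (ι → ℝ) → E} (hf : Integrable f) :
    HasSum (fun m : ι → ℤ => ∫ x in unitCube 0, f (x + fun i => (m i : ℝ))) (∫ x, f x) := by
  have htile := hasSum_integral_iUnion (μ := volume) (f := f) measurableSet_unitCube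
    pairwise_disjoint_unitCube hf.integrableOn
  rw [iUnion_unitCube, setIntegral_univ] at htile
  exact htile.congr_fun fun m => (setIntegral_unitCube f m).symm

theorem integral_eq_setIntegral_unitCube_tsum {f : (ι → ℝ) → E} (hf : Integrable f) :
    ∫ x, f x = ∫ x in unitCube 0, ∑' m : ι → ℤ, f (x + fun i => (m i : ℝ)) := by
  rw [← (hasSum_setIntegral_unitCube hf).tsum_eq, integral_tsum_of_summable_integral_norm
    (fun m => (hf.comp_add_right _).integrableOn) (hasSum_setIntegral_unitCube hf.norm).summable]

end UnitCube

section Torus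

variable {n : ℕ}

theorem intVec_neg (m : Fin n → ℤ) : intVec (-m) = -intVec m := by
  ext i
  simp [intVec]

theorem intVec_add (m k : Fin n → ℤ) : intVec (m + k) = intVec m + intVec k := by
  ext i
  simp [intVec]

theorem intVec_sub (m k : Fin n → ℤ) : intVec (m - k) = intVec m - intVec k := by
  ext i
  simp [intVec]

theorem intVec_nsmul (c : ℕ) (m : Fin n → ℤ) : intVec (c • m) = (c : ℝ) • intVec m := by
  ext i
  simp [intVec]

/-- The quotient map from `ℝⁿ` to the torus `ℝⁿ / ℤⁿ`. -/
def torusMk (n : ℕ) : C(Config n, UnitAddTorus (Fin n)) :=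
  ⟨fun x i => (x i : UnitAddCircle), continuous_pi fun i =>
    (AddCircle.continuous_mk' 1).comp (EuclideanSpace.proj (𝕜 := ℝ) i).continuous⟩

theorem isQuotientMap_torusMk : Topology.IsQuotientMap (torusMk n) := by
  have hpi : IsOpenQuotientMap (Pi.map fun (_ : Fin n) (x : ℝ) => (x : UnitAddCircle)) :=
    .piMap fun _ => QuotientAddGroup.isOpenQuotientMap_mk
  exact hpi.isQuotientMap.comp (PiLp.homeomorph 2 fun _ : Fin n => ℝ).isQuotientMap

theorem exists_eq_add_intVec_of_torusMk_eq {x y : Config n} (hxy : torusMk n x = torusMk n y) :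
    ∃ m : Fin n → ℤ, x = y + intVec m := by
  have hcoord (i : Fin n) : ∃ k : ℤ, k • (1 : ℝ) = x i - y i := by
    rw [← AddCircle.coe_eq_zero_iff, AddCircle.coe_sub, sub_eq_zero]
    exact congrFun hxy i
  choose m hm using hcoord
  exact ⟨m, by ext i; simpa [intVec, sub_eq_iff_eq_add'] using (hm i).symm⟩

theorem torusMk_add_intVec (x : Config n) (m : Fin n → ℤ) :
    torusMk n (x + intVec m) = torusMk n x := by
  ext i
  simp only [torusMk, intVec, ContinuousMap.coe_mk, PiLp.add_apply, AddCircle.coe_add,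
    add_eq_left, AddCircle.coe_eq_zero_iff]
  exact ⟨m i, by simp⟩

theorem mFourier_torusMk (q : Fin n → ℤ) (x : Config n) :
    UnitAddTorus.mFourier q (torusMk n x) = 𝐞 (inner ℝ x (intVec q)) := by
  simp only [UnitAddTorus.mFourier, torusMk, intVec, ContinuousMap.coe_mk, fourier_coe_apply,
    ← Complex.exp_sum, Real.fourierChar_apply, PiLp.inner_apply, RCLike.inner_apply, conj_trivial]
  push_cast
  rw [Finset.mul_sum, Finset.sum_mul]
  exact congrArg Complex.exp (Finset.sum_congr rfl fun i _ => by ring)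

theorem fourier_intVec {E : Type*} [NormedAddCommGroup E] [NormedSpace ℂ E] (f : Config n → E)
    (q : Fin n → ℤ) :
    𝓕 f (intVec q) = ∫ x, UnitAddTorus.mFourier (-q) (torusMk n x) • f x := by
  simp only [Real.fourier_eq, mFourier_torusMk, intVec_neg, inner_neg_right, Circle.smul_def]

/-- The sum of all integer translates of `f`, a continuous function as the translates are summable
in the topology of locally uniform convergence; it is `0` (a junk value) where they are not. -/
def periodization (f : C(Config n, ℂ)) : C(Config n, ℂ) :=
  ∑' m : Fin n → ℤ, f.comp (ContinuousMap.addRight (intVec m))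

theorem periodization_apply {f : C(Config n, ℂ)}
    (hf : Summable fun m : Fin n → ℤ => f.comp (ContinuousMap.addRight (intVec m)))
    (x : Config n) : periodization f x = ∑' m : Fin n → ℤ, f (x + intVec m) :=
  (ContinuousMap.tsum_apply hf x).symm

theorem periodization_add_intVec (f : C(Config n, ℂ)) (x : Config n) (k : Fin n → ℤ) :
    periodization f (x + intVec k) = periodization f x := by
  by_cases hf : Summable fun m : Fin n → ℤ => f.comp (ContinuousMap.addRight (intVec m))
  · rw [periodization_apply hf, periodization_apply hf,
      ← (Equiv.addLeft k).tsum_eq fun m => f (x + intVec m)]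
    simp only [Equiv.coe_addLeft, intVec_add, add_assoc]
  · simp [periodization, tsum_eq_zero_of_not_summable hf]

theorem factorsThrough_periodization (f : C(Config n, ℂ)) :
    Function.FactorsThrough (periodization f) (torusMk n) := fun x y hxy => by
  obtain ⟨m, rfl⟩ := exists_eq_add_intVec_of_torusMk_eq hxy
  exact periodization_add_intVec f y m

/-- The periodization of `f` as a function on the torus. -/
def torusPeriodization (f : C(Config n, ℂ)) : C(UnitAddTorus (Fin n), ℂ) :=
  isQuotientMap_torusMk.lift (periodization f) (factorsThrough_periodization f)

theorem torusPeriodization_torusMk (f : C(Config n, ℂ)) (x : Config n) :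
    torusPeriodization f (torusMk n x) = periodization f x :=
  DFunLike.congr_fun (isQuotientMap_torusMk.lift_comp (periodization f)
    (factorsThrough_periodization f)) x

theorem mFourierCoeff_torusPeriodization {f : C(Config n, ℂ)} (hint : Integrable f)
    (hf : Summable fun m : Fin n → ℤ => f.comp (ContinuousMap.addRight (intVec m)))
    (q : Fin n → ℤ) :
    UnitAddTorus.mFourierCoeff (torusPeriodization f) q = 𝓕 (f : Config n → ℂ) (intVec q) := by
  let g : Config n → ℂ := fun x => UnitAddTorus.mFourier (-q) (torusMk n x) • f x
  have hg : Integrable g := by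
    refine hint.bdd_mul (c := 1) ?_ (.of_forall fun x => ?_)
    · fun_prop
    · rw [mFourier_torusMk, Circle.norm_coe]
  have hvol := PiLp.volume_preserving_toLp (Fin n)
  have hemb := (MeasurableEquiv.toLp 2 (Fin n → ℝ)).measurableEmbedding
  have hcube : {x : Fin n → ℝ | ∀ i, x i ∈ Set.Ioc ((0 : Fin n → ℝ) i) ((0 : Fin n → ℝ) i + 1)} =
      unitCube 0 := by simp [unitCube]
  have hgsum (x : Config n) : ∑' m : Fin n → ℤ, g (x + intVec m) =
      UnitAddTorus.mFourier (-q) (torusMk n x) • torusPeriodization f (torusMk n x) := by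
    simp only [g, torusMk_add_intVec, smul_eq_mul, tsum_mul_left, torusPeriodization_torusMk,
      periodization_apply hf]
  calc UnitAddTorus.mFourierCoeff (torusPeriodization f) q
      = ∫ x in unitCube (0 : Fin n → ℤ), UnitAddTorus.mFourier (-q) (torusMk n (WithLp.toLp 2 x)) •
          torusPeriodization f (torusMk n (WithLp.toLp 2 x)) := by
        rw [UnitAddTorus.mFourierCoeff_eq_integral _ _ 0, hcube]
        rfl
    _ = ∫ x in unitCube 0, ∑' m : Fin n → ℤ, g (WithLp.toLp 2 x + intVec m) := by
        simp only [hgsum]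
    _ = ∫ x : Fin n → ℝ, g (WithLp.toLp 2 x) :=
        (integral_eq_setIntegral_unitCube_tsum ((hvol.integrable_comp_emb hemb).2 hg)).symm
    _ = ∫ x, g x := hvol.integral_comp hemb g
    _ = 𝓕 (f : Config n → ℂ) (intVec q) := (fourier_intVec f q).symm

theorem tsum_eq_tsum_fourier {f : C(Config n, ℂ)} (hint : Integrable f)
    (hf : Summable fun m : Fin n → ℤ => f.comp (ContinuousMap.addRight (intVec m)))
    (hFf : Summable fun q : Fin n → ℤ => 𝓕 (f : Config n → ℂ) (intVec q)) (x : Config n) :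
    ∑' m : Fin n → ℤ, f (x + intVec m) =
      ∑' q : Fin n → ℤ,
        𝓕 (f : Config n → ℂ) (intVec q) * UnitAddTorus.mFourier q (torusMk n x) := by
  have hcoeff := funext (mFourierCoeff_torusPeriodization hint hf)
  have hseries := UnitAddTorus.hasSum_mFourier_series_apply_of_summable (hcoeff ▸ hFf) (torusMk n x)
  rw [torusPeriodization_torusMk, periodization_apply hf, hcoeff] at hseries
  exact hseries.tsum_eq.symm

theorem summable_comp_addRight_intVec (f : 𝓢(Config n, ℂ)) :
    Summable fun m : Fin n → ℤ =>
      (f : C(Config n, ℂ)).comp (ContinuousMap.addRight (intVec m)) := by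
  obtain ⟨C, hC, hdecay⟩ := exists_norm_le_mul_inv_one_add_norm_pow f (n + 1)
  refine ContinuousMap.summable_of_locally_summable_norm fun K => ?_
  obtain ⟨R, hR⟩ := K.isCompact.isBounded.exists_norm_le
  have hsum : Summable fun m : Fin n → ℤ =>
      C * ((1 + |R|) ^ (n + 1) * ((1 + ‖(1 : ℝ) • intVec m‖) ^ (n + 1))⁻¹) :=
    ((summable_inv_one_add_norm_smul_intVec n.lt_succ_self one_ne_zero).mul_left _).mul_left _
  refine hsum.of_nonneg_of_le (fun _ => norm_nonneg _) fun m =>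
    (ContinuousMap.norm_le _ (by positivity)).2 fun ⟨x, hx⟩ => ?_
  calc ‖f (x + intVec m)‖
      ≤ C * ((1 + ‖-x - intVec m‖) ^ (n + 1))⁻¹ := by
        rw [← neg_add', norm_neg]
        exact hdecay _
    _ ≤ C * ((1 + ‖-x‖) ^ (n + 1) * ((1 + ‖intVec m‖) ^ (n + 1))⁻¹) := by
        gcongr
        exact inv_one_add_norm_sub_pow_le _ _ _
    _ ≤ C * ((1 + |R|) ^ (n + 1) * ((1 + ‖(1 : ℝ) • intVec m‖) ^ (n + 1))⁻¹) := by
        rw [norm_neg, one_smul]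
        gcongr
        exact (hR x hx).trans (le_abs_self R)

theorem tsum_schwartzMap_eq_tsum_fourier (f : 𝓢(Config n, ℂ)) :
    ∑' m : Fin n → ℤ, f (intVec m) = ∑' q : Fin n → ℤ, 𝓕 f (intVec q) := by
  have hFf : Summable fun q : Fin n → ℤ => 𝓕 (f : Config n → ℂ) (intVec q) := by
    simpa only [one_smul, SchwartzMap.fourier_coe] using
      (summable_norm_smul_intVec (𝓕 f) one_ne_zero).of_norm
  simpa [mFourier_torusMk, SchwartzMap.fourier_coe] using
    tsum_eq_tsum_fourier f.integrable (summable_comp_addRight_intVec f) hFf 0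

theorem tsum_fourierInv_eq_tsum (f : 𝓢(Config n, ℂ)) :
    ∑' q : Fin n → ℤ, 𝓕⁻ f (intVec q) = ∑' m : Fin n → ℤ, f (intVec m) := by
  rw [tsum_schwartzMap_eq_tsum_fourier, FourierTransform.fourier_fourierInv_eq]

end Torus

/-- The unimodular change of coordinates `(v, s) ↦ (p, k)` under which `d k - (r + 1) p` and
`d k - r p`, for `d = 2 r + 1`, become `v` and `d s - v`. -/
def unimodularEquiv (A : Type*) [AddCommGroup A] (r : ℕ) : A × A ≃ A × A where
  toFun t := ((2 * r + 1) • t.2 - 2 • t.1, (r + 1) • t.2 - t.1)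
  invFun t := ((2 * r + 1) • t.2 - (r + 1) • t.1, 2 • t.2 - t.1)
  left_inv t := by ext <;> dsimp only <;> module
  right_inv t := by ext <;> dsimp only <;> module

section Residues

variable {ι : Type*} {d : ℕ}

theorem tsum_nsmul_sub_residue {M : Type*} [AddCommMonoid M] [TopologicalSpace M]
    (G : (ι → ℤ) → M) (j m : ι → ℤ) :
    ∑' s : ι → ℤ, G (d • s - fun i => d * m i + j i) = ∑' s : ι → ℤ, G fun i => d * s i + -j i := by
  rw [← (Equiv.addRight m).tsum_eq fun s : ι → ℤ => G (d • s - fun i => d * m i + j i)]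
  refine tsum_congr fun s => congrArg G (funext fun i => ?_)
  simp only [Equiv.coe_addRight, Pi.sub_apply, Pi.add_apply, nsmul_eq_mul, smul_add,
    Pi.mul_apply, Pi.natCast_apply]
  ring

theorem summable_mul_nsmul_sub {R : Type*} [NormedRing R] [CompleteSpace R] {F G : (ι → ℤ) → R}
    (hd : d ≠ 0) (hF : Summable fun v => ‖F v‖) (hG : Summable fun v => ‖G v‖) :
    Summable fun t : (ι → ℤ) × (ι → ℤ) => F t.1 * G (d • t.2 - t.1) := by
  have hinj : Function.Injective fun t : (ι → ℤ) × (ι → ℤ) => (t.1, d • t.2 - t.1) := by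
    intro t t' heq
    obtain ⟨hfst, hsub⟩ := Prod.mk.inj heq
    rw [hfst] at hsub
    exact Prod.ext hfst (smul_right_injective _ hd (sub_left_injective hsub))
  exact ((hF.mul_norm hG).comp_injective hinj).of_norm

variable [Fintype ι] [DecidableEq ι] [NeZero d]

theorem tsum_eq_sum_tsum_residue {E : Type*} [NormedAddCommGroup E] [CompleteSpace E]
    {K : (ι → ℤ) → E} (hK : Summable K) :
    ∑' v, K v = ∑ j : ι → Fin d, ∑' m : ι → ℤ, K fun i => d * m i + (j i : ℤ) := by
  let e : (ι → Fin d) × (ι → ℤ) ≃ (ι → ℤ) := (Equiv.prodComm _ _).trans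
    ((Equiv.piCongrRight fun _ => Int.divModEquiv d).trans
      (Equiv.arrowProdEquivProdArrow _ _ _)).symm
  have he (j : ι → Fin d) (m : ι → ℤ) : e (j, m) = fun i => d * m i + (j i : ℤ) :=
    funext fun i => congrArg (· + (j i : ℤ)) (mul_comm (m i) d)
  rw [← e.tsum_eq, Summable.tsum_prod (f := fun t => K (e t)) (e.summable_iff.2 hK), tsum_fintype]
  simp only [he]

variable {𝕜 : Type*} [NormedField 𝕜] [CompleteSpace 𝕜] {F G : (ι → ℤ) → 𝕜}

theorem tsum_tsum_mul_nsmul_sub (hF : Summable fun v => ‖F v‖) (hG : Summable fun v => ‖G v‖) :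
    ∑' v, ∑' s : ι → ℤ, F v * G (d • s - v) = ∑ j : ι → Fin d,
      (∑' m : ι → ℤ, F fun i => d * m i + (j i : ℤ)) *
        ∑' m : ι → ℤ, G fun i => d * m i + -(j i : ℤ) := by
  rw [tsum_eq_sum_tsum_residue (d := d) (summable_mul_nsmul_sub (NeZero.ne d) hF hG).prod]
  simp only [tsum_mul_left, tsum_nsmul_sub_residue, tsum_mul_right]

end Residues

theorem tsum_tsum_mul_eq_sum_residue {ι : Type*} [Fintype ι] [DecidableEq ι] {𝕜 : Type*}
    [NormedField 𝕜] [CompleteSpace 𝕜] {d r : ℕ} (hr : d = 2 * r + 1) {F G : (ι → ℤ) → 𝕜}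
    (hF : Summable fun v => ‖F v‖) (hG : Summable fun v => ‖G v‖) :
    ∑' p : ι → ℤ, ∑' k : ι → ℤ, F (d • k - (r + 1) • p) * G (d • k - r • p) =
      ∑ j : ι → Fin d, (∑' m : ι → ℤ, F fun i => d * m i + (j i : ℤ)) *
        ∑' m : ι → ℤ, G fun i => d * m i + -(j i : ℤ) := by
  have : NeZero d := ⟨by omega⟩
  let e := unimodularEquiv (ι → ℤ) r
  let K : (ι → ℤ) × (ι → ℤ) → 𝕜 := fun t => F (d • t.2 - (r + 1) • t.1) * G (d • t.2 - r • t.1)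
  have hKe (t) : K (e t) = F t.1 * G (d • t.2 - t.1) := by
    simp only [K, e, unimodularEquiv, Equiv.coe_fn_mk, hr]
    congr 2 <;> module
  have hKe_sum : Summable (K ∘ e) :=
    (summable_mul_nsmul_sub (NeZero.ne d) hF hG).congr fun t => (hKe t).symm
  have hK : Summable K := e.summable_iff.1 hKe_sum
  calc ∑' p, ∑' k, K (p, k) = ∑' t, K t := hK.tsum_prod.symm
    _ = ∑' t, K (e t) := (e.tsum_eq K).symm
    _ = ∑' v, ∑' s, K (e (v, s)) := hKe_sum.tsum_prod
    _ = ∑' v, ∑' s, F v * G (d • s - v) := by simp only [hKe]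
    _ = _ := tsum_tsum_mul_nsmul_sub hF hG

section MatrixElements

variable {n : ℕ}

theorem T_apply (d : ℕ) (a : PhaseSpace n) (f : 𝓢(Config n, ℂ)) (x : Config n) :
    T d a f x = Complex.exp ((spacing d * inner ℝ a.2 x
      - spacing d ^ 2 / 2 * inner ℝ a.1 a.2 : ℝ) * Complex.I) * f (x - spacing d • a.1) := by
  rw [T, displacement_apply]
  congr 2
  simp only [Prod.fst_neg, Prod.snd_neg, Prod.smul_fst, Prod.smul_snd, inner_neg_left,
    inner_neg_right, real_inner_smul_left, real_inner_smul_right]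
  push_cast
  ring

theorem norm_T_apply (d : ℕ) (a : PhaseSpace n) (f : 𝓢(Config n, ℂ)) (x : Config n) :
    ‖T d a f x‖ = ‖f (x - spacing d • a.1)‖ := by
  rw [T_apply, norm_mul, Complex.norm_exp_ofReal_mul_I, one_mul]

theorem fourier_T_apply (d : ℕ) (a : PhaseSpace n) (f : 𝓢(Config n, ℂ)) (ξ : Config n) :
    𝓕 (T d a f) ξ = Complex.exp ((spacing d ^ 2 / 2 * inner ℝ a.1 a.2
      - 2 * Real.pi * spacing d * inner ℝ a.1 ξ : ℝ) * Complex.I) *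
        𝓕 f (ξ - (spacing d / (2 * Real.pi)) • a.2) := by
  rw [SchwartzMap.fourier_coe, SchwartzMap.fourier_coe, Real.fourier_eq', Real.fourier_eq',
    ← integral_add_right_eq_self _ (spacing d • a.1), ← integral_const_mul]
  congr 1 with v
  rw [T_apply, smul_eq_mul, smul_eq_mul, ← mul_assoc, ← mul_assoc, ← Complex.exp_add,
    ← Complex.exp_add, add_sub_cancel_right, ← add_mul, ← add_mul, ← Complex.ofReal_add,
    ← Complex.ofReal_add]
  congr 4
  simp only [inner_add_left, inner_add_right, inner_sub_right, real_inner_smul_left,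
    real_inner_smul_right, real_inner_comm v a.2, real_inner_comm a.1 a.2]
  field_simp
  ring

theorem norm_fourier_T_apply (d : ℕ) (a : PhaseSpace n) (f : 𝓢(Config n, ℂ)) (ξ : Config n) :
    ‖𝓕 (T d a f) ξ‖ = ‖𝓕 f (ξ - (spacing d / (2 * Real.pi)) • a.2)‖ := by
  rw [fourier_T_apply, norm_mul, Complex.norm_exp_ofReal_mul_I, one_mul]

theorem toGenOp_apply_eq_integral_fourier (L : 𝓢(Config n, ℂ) →L[ℂ] 𝓢(Config n, ℂ))
    (f g : 𝓢(Config n, ℂ)) : toGenOp L f g = ∫ ξ, 𝓕⁻ g ξ * 𝓕 (L f) ξ := by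
  rw [toGenOp_apply, ← SchwartzMap.integral_fourier_mul_eq,
    FourierTransform.fourier_fourierInv_eq]

theorem exists_norm_toGenOp_T_le_position (d : ℕ) (f g : 𝓢(Config n, ℂ)) (N : ℕ) :
    ∃ C, 0 ≤ C ∧ ∀ a : PhaseSpace n,
      ‖toGenOp (T d a) f g‖ ≤ C * ((1 + ‖spacing d • a.1‖) ^ N)⁻¹ := by
  obtain ⟨C, hC, hdecay⟩ := exists_integral_norm_mul_norm_sub_le volume g f N
  refine ⟨C, hC, fun a => le_trans ?_ (hdecay _)⟩
  rw [toGenOp_apply]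
  simpa only [norm_mul, norm_T_apply] using
    norm_integral_le_integral_norm fun x => g x * T d a f x

theorem exists_norm_toGenOp_T_le_momentum (d : ℕ) (f g : 𝓢(Config n, ℂ)) (N : ℕ) :
    ∃ C, 0 ≤ C ∧ ∀ a : PhaseSpace n,
      ‖toGenOp (T d a) f g‖ ≤ C * ((1 + ‖(spacing d / (2 * Real.pi)) • a.2‖) ^ N)⁻¹ := by
  obtain ⟨C, hC, hdecay⟩ := exists_integral_norm_mul_norm_sub_le volume (𝓕⁻ g) (𝓕 f) N
  refine ⟨C, hC, fun a => le_trans ?_ (hdecay _)⟩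
  rw [toGenOp_apply_eq_integral_fourier]
  simpa only [norm_mul, norm_fourier_T_apply] using
    norm_integral_le_integral_norm fun ξ => 𝓕⁻ g ξ * 𝓕 (T d a f) ξ

theorem le_add_mul_mul_of_le_mul_sq {A B w x y : ℝ} (hA : 0 ≤ A) (hB : 0 ≤ B) (hx : 0 ≤ x)
    (hy : 0 ≤ y) (hwx : w ≤ A * x ^ 2) (hwy : w ≤ B * y ^ 2) : w ≤ (A + B) * (x * y) := by
  rcases le_total x y with hxy | hyx
  · calc w ≤ A * (x * x) := by rwa [← sq]
      _ ≤ (A + B) * (x * y) := by gcongr; exact le_add_of_nonneg_right hB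
  · calc w ≤ B * (y * y) := by rwa [← sq]
      _ ≤ (A + B) * (x * y) := by gcongr; exact le_add_of_nonneg_left hA

theorem summable_norm_toGenOp_T {d : ℕ} (hd : d ≠ 0) (f g : 𝓢(Config n, ℂ)) :
    Summable fun a : (Fin n → ℤ) × (Fin n → ℤ) => ‖toGenOp (T d (intPhase a)) f g‖ := by
  have hl := spacing_pos hd
  obtain ⟨A, hA, hposition⟩ := exists_norm_toGenOp_T_le_position d f g ((n + 1) * 2)
  obtain ⟨B, hB, hmomentum⟩ := exists_norm_toGenOp_T_le_momentum d f g ((n + 1) * 2)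
  simp only [pow_mul, ← inv_pow (_ ^ (n + 1))] at hposition hmomentum
  have hsum := ((summable_inv_one_add_norm_smul_intVec n.lt_succ_self hl.ne').mul_of_nonneg
    (summable_inv_one_add_norm_smul_intVec n.lt_succ_self (div_pos hl Real.two_pi_pos).ne')
    (fun _ => by positivity) fun _ => by positivity).mul_left (A + B)
  exact hsum.of_nonneg_of_le (fun _ => norm_nonneg _) fun a =>
    le_add_mul_mul_of_le_mul_sq hA hB (inv_nonneg.2 (by positivity)) (inv_nonneg.2 (by positivity))
      (hposition (intPhase a)) (hmomentum (intPhase a))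

end MatrixElements

section Rescaling

variable {E : Type*} [NormedAddCommGroup E] [NormedSpace ℝ E]

/-- The function `x ↦ f (s x - b) g (s x - c)`, whose inverse Fourier transform gives the matrix
elements of the displacement operators; the scale `s = d ℓ` turns their frequencies into integer
vectors. -/
def rescaledProduct (f g : 𝓢(E, ℂ)) {s : ℝ} (hs : s ≠ 0) (b c : E) : 𝓢(E, ℂ) :=
  SchwartzMap.compCLMOfContinuousLinearEquiv ℂ (ContinuousLinearEquiv.smulLeft (Units.mk0 s hs))
    (SchwartzMap.smulLeftCLM ℂ (SchwartzMap.compSubConstCLM ℂ b f)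
      (SchwartzMap.compSubConstCLM ℂ c g))

theorem rescaledProduct_apply (f g : 𝓢(E, ℂ)) {s : ℝ} (hs : s ≠ 0) (b c x : E) :
    rescaledProduct f g hs b c x = f (s • x - b) * g (s • x - c) := by
  simp only [rescaledProduct, SchwartzMap.compCLMOfContinuousLinearEquiv_apply,
    Function.comp_apply, SchwartzMap.smulLeftCLM_apply_apply (SchwartzMap.hasTemperateGrowth _),
    SchwartzMap.compSubConstCLM_apply, smul_eq_mul]
  rfl

theorem integral_eq_pow_smul_integral_comp_smul_sub {F : Type*}
    [NormedAddCommGroup F] [NormedSpace ℝ F] [MeasurableSpace E] [BorelSpace E]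
    [FiniteDimensional ℝ E] (μ : Measure E) [μ.IsAddHaarMeasure] (G : E → F) {s : ℝ} (hs : 0 < s)
    (b : E) :
    ∫ x, G x ∂μ = s ^ Module.finrank ℝ E • ∫ x, G (s • x - b) ∂μ := by
  rw [Measure.integral_comp_smul μ fun x => G (x - b), integral_sub_right_eq_self,
    abs_of_pos (by positivity), smul_inv_smul₀ (by positivity)]

end Rescaling

section PhasePoint

variable {d r n : ℕ}

theorem phasePointTerm_zero_apply (a : (Fin n → ℤ) × (Fin n → ℤ)) (f g : 𝓢(Config n, ℂ)) :
    phasePointTerm d (0 : PhaseSpace n) a f g =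
      Complex.exp ((Real.pi * inner ℝ (intVec a.1) (intVec a.2) : ℝ) * Complex.I) *
        toGenOp (T d (intPhase a)) f g := by
  have hsymp : symp (intPhase a) 0 = 0 := by simp [symp]
  rw [phasePointTerm, hsymp, mul_zero, zero_add]
  rfl

theorem summable_phasePointTerm_zero_apply (hd : d ≠ 0) (f g : 𝓢(Config n, ℂ)) :
    Summable fun a : (Fin n → ℤ) × (Fin n → ℤ) => phasePointTerm d (0 : PhaseSpace n) a f g := by
  refine .of_norm_bounded (summable_norm_toGenOp_T hd f g) fun a => le_of_eq ?_
  rw [phasePointTerm_zero_apply, norm_mul, Complex.norm_exp_ofReal_mul_I, one_mul]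

theorem spacing_sq_mul (hd : d ≠ 0) : spacing d ^ 2 * d = 2 * Real.pi := by
  rw [spacing, Real.sq_sqrt (by positivity), div_mul_cancel₀ _ (Nat.cast_ne_zero.2 hd)]

theorem ofReal_mul_spacing_eq (hd : d ≠ 0) :
    ((d * spacing d : ℝ) : ℂ) = 2 * Real.pi * (1 / spacing d) := by
  have hl : (spacing d : ℂ) ≠ 0 := Complex.ofReal_ne_zero.2 (spacing_pos hd).ne'
  have hsq : (spacing d : ℂ) ^ 2 * d = 2 * Real.pi := by exact_mod_cast spacing_sq_mul hd
  rw [← hsq]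
  push_cast
  field_simp

-- The phase `π p · q` of the summand, less the phase `ℓ² p · q / 2` in `T`, is thus the phase
-- `ℓ q · (ℓ r p)` of a translation of the position by the lattice vector `ℓ r p`.
theorem pi_sub_spacing_sq_div_two (hr : d = 2 * r + 1) :
    Real.pi - spacing d ^ 2 / 2 = spacing d ^ 2 * r := by
  have hsq := spacing_sq_mul (d := d) (by omega)
  have hdr : (d : ℝ) = 2 * r + 1 := by exact_mod_cast hr
  linear_combination (-(1 / 2 : ℝ)) * hsq + spacing d ^ 2 / 2 * hdr

theorem phasePointTerm_zero_apply_eq_integral (hr : d = 2 * r + 1) (p q : Fin n → ℤ)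
    (f g : 𝓢(Config n, ℂ)) :
    phasePointTerm d (0 : PhaseSpace n) (p, q) f g =
      ∫ x, Complex.exp ((spacing d * inner ℝ (x + spacing d • intVec (r • p)) (intVec q) : ℝ) *
        Complex.I) * (f (x - spacing d • intVec p) * g x) := by
  rw [phasePointTerm_zero_apply, toGenOp_apply, ← integral_const_mul]
  congr 1 with x
  rw [T_apply, mul_left_comm (g x), ← mul_assoc, ← Complex.exp_add, ← add_mul,
    ← Complex.ofReal_add, mul_comm (g x)]
  congr 4
  rw [intPhase, intVec_nsmul, inner_add_left, real_inner_smul_left, real_inner_smul_left,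
    real_inner_comm x]
  linear_combination inner ℝ (intVec p) (intVec q) * pi_sub_spacing_sq_div_two hr

theorem phasePointTerm_zero_apply_eq_fourierInv (hr : d = 2 * r + 1) (hs : 0 < d * spacing d)
    (p q : Fin n → ℤ) (f g : 𝓢(Config n, ℂ)) :
    phasePointTerm d (0 : PhaseSpace n) (p, q) f g = ((d * spacing d : ℝ) : ℂ) ^ n *
      𝓕⁻ (rescaledProduct f g hs.ne' (spacing d • intVec ((r + 1) • p))
        (spacing d • intVec (r • p))) (intVec q) := by
  have hsq := spacing_sq_mul (d := d) (by omega)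
  rw [phasePointTerm_zero_apply_eq_integral hr, integral_eq_pow_smul_integral_comp_smul_sub volume
    _ hs (spacing d • intVec (r • p)), finrank_euclideanSpace_fin, Complex.real_smul,
    Complex.ofReal_pow, SchwartzMap.fourierInv_coe, Real.fourierInv_eq']
  congr 2 with x
  rw [sub_add_cancel, real_inner_smul_left, rescaledProduct_apply, sub_sub, ← smul_add,
    ← intVec_add, ← succ_nsmul, smul_eq_mul, ← hsq]
  congr 4
  ring

theorem rescaledProduct_intVec (hs : d * spacing d ≠ 0) (u v k : Fin n → ℤ)
    (f g : 𝓢(Config n, ℂ)) :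
    rescaledProduct f g hs (spacing d • intVec u) (spacing d • intVec v) (intVec k) =
      f (spacing d • intVec (d • k - u)) * g (spacing d • intVec (d • k - v)) := by
  rw [rescaledProduct_apply, intVec_sub, intVec_sub, intVec_nsmul d, smul_sub, smul_sub, smul_smul,
    mul_comm (spacing d)]

end PhasePoint

section LogicalParity

variable {d n : ℕ}

theorem bra_gkpKetMulti (hd : d ≠ 0) (j : Fin n → ℤ) (f : 𝓢(Config n, ℂ)) :
    bra (gkpKetMulti d j) f = gkpKetMulti d j f := by
  change (starRingEnd ℂ) (gkpKetMulti d j (conjS f)) = _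
  rw [gkpKetMulti_apply hd, gkpKetMulti_apply hd, map_mul, Complex.conj_tsum]
  simp [conjS_apply]

theorem logicalParity_apply (hd : d ≠ 0) (f g : 𝓢(Config n, ℂ)) :
    logicalParity d n f g = (1 / (spacing d : ℂ)) ^ n * ∑ j : Fin n → Fin d,
      (∑' m : Fin n → ℤ, f (spacing d • intVec fun k => d * m k + (j k : ℤ))) *
        ∑' m : Fin n → ℤ, g (spacing d • intVec fun k => d * m k + -(j k : ℤ)) := by
  have hsum : logicalParity d n f g = ∑ j : Fin n → Fin d,
      bra (gkpKetMulti d fun k => (j k : ℤ)) f * gkpKetMulti d (fun k => -(j k : ℤ)) g := by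
    simp [logicalParity, ketBra_apply, bra]
  have hsqrt : (1 / Real.sqrt (spacing d) : ℂ) * (1 / Real.sqrt (spacing d) : ℂ) =
      1 / (spacing d : ℂ) := by
    rw [div_mul_div_comm, one_mul, ← Complex.ofReal_mul, Real.mul_self_sqrt (spacing_pos hd).le]
  rw [hsum, Finset.mul_sum]
  refine Finset.sum_congr rfl fun j _ => ?_
  rw [bra_gkpKetMulti hd, gkpKetMulti_apply hd, gkpKetMulti_apply hd, ← hsqrt, mul_pow]
  ring

theorem tsum_phasePointTerm_zero_apply (hd : Odd d) (f g : 𝓢(Config n, ℂ)) :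
    ∑' a : (Fin n → ℤ) × (Fin n → ℤ), phasePointTerm d (0 : PhaseSpace n) a f g =
      (2 * Real.pi : ℂ) ^ n * logicalParity d n f g := by
  obtain ⟨r, hr⟩ := hd
  have hd0 : d ≠ 0 := by omega
  have hl := spacing_pos hd0
  have hs : 0 < d * spacing d := by positivity
  calc ∑' a : (Fin n → ℤ) × (Fin n → ℤ), phasePointTerm d (0 : PhaseSpace n) a f g
      = ∑' p : Fin n → ℤ, ∑' q : Fin n → ℤ, ((d * spacing d : ℝ) : ℂ) ^ n *
          𝓕⁻ (rescaledProduct f g hs.ne' (spacing d • intVec ((r + 1) • p))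
            (spacing d • intVec (r • p))) (intVec q) := by
        rw [(summable_phasePointTerm_zero_apply hd0 f g).tsum_prod]
        simp only [phasePointTerm_zero_apply_eq_fourierInv hr hs]
    _ = ((d * spacing d : ℝ) : ℂ) ^ n * ∑' p : Fin n → ℤ, ∑' k : Fin n → ℤ,
          f (spacing d • intVec (d • k - (r + 1) • p)) *
            g (spacing d • intVec (d • k - r • p)) := by
        simp only [tsum_mul_left, tsum_fourierInv_eq_tsum, rescaledProduct_intVec]
    _ = (2 * Real.pi : ℂ) ^ n * logicalParity d n f g := by
        rw [tsum_tsum_mul_eq_sum_residue hr (summable_norm_smul_intVec f hl.ne')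
          (summable_norm_smul_intVec g hl.ne'), logicalParity_apply hd0, ofReal_mul_spacing_eq hd0,
          mul_pow, mul_assoc]

theorem hasSum_phasePointTerm_zero (hd : Odd d) :
    HasSum (fun a : (Fin n → ℤ) × (Fin n → ℤ) => phasePointTerm d (0 : PhaseSpace n) a)
      ((2 * Real.pi : ℂ) ^ n • logicalParity d n) := by
  rw [HasSum, PointwiseConvergenceCLM.tendsto_iff_forall_tendsto]
  intro f
  rw [PointwiseConvergenceCLM.tendsto_iff_forall_tendsto]
  intro g
  have hfg := (summable_phasePointTerm_zero_apply hd.pos.ne' f g).hasSum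
  rw [tsum_phasePointTerm_zero_apply hd, HasSum] at hfg
  simpa using hfg

end LogicalParity

end GKP

end

theorem lemma3 (d n : ℕ) (hd : Odd d) :
    Summable (fun a : (Fin n → ℤ) × (Fin n → ℤ) => GKP.phasePointTerm d (0 : GKP.PhaseSpace n) a) ∧
      GKP.phasePoint d (0 : GKP.PhaseSpace n) = GKP.logicalParity d n := by
  have hsum := GKP.hasSum_phasePointTerm_zero (n := n) hd
  have hpow : (2 * Real.pi : ℂ) ^ n ≠ 0 := pow_ne_zero _ (by simp [Real.pi_ne_zero])
  refine ⟨hsum.summable, ?_⟩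
  rw [GKP.phasePoint, hsum.tsum_eq, smul_smul, one_div_mul_cancel hpow, one_smul]
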